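/- Let $K$ be a field with a valuation $\nu$, let $\tilde\Gamma$ be a totally ordered abelian group, and let all valuations take values in $\tilde\Gamma\cup\{\infty\}$; valuations of $K[x]$ extend $\nu$ and take the value $\infty$ only at $0$. For a valuation $\mu$ of $K[x]$, say that $\phi$ $\mu$-divides $f$ if $\mu(f-h\phi)>\mu(f)$ for some $h\in K[x]$ (so $0$ is not $\mu$-divisible by any polynomial). A key polynomial for $\mu$ is a monic non-constant $\phi$ such that every $f$ that is $\mu$-divisible by $\phi$ has $\deg f\ge\deg\phi$, and such that $\phi$ $\mu$-divides $f$ or $g$ whenever it $\mu$-divides $fg$. If $\phi$ is a key polynomial for $\mu$ and $\gamma\in\tilde\Gamma$, $\gamma>\mu(\phi)$, the augmented valuation $[\mu;\phi,\gamma]$ sends $f=\sum_j g_j\phi^j$ (with $\deg g_j<\deg\phi$) to $\inf_j(\mu(g_j)+j\gamma)$. Let $A$ be a nonempty totally ordered set without greatest element, and let $\mathcal C=(\mu_\alpha)_{\alpha\in A}$ be a continuous admissible family of valuations of $K[x]$. This means that there are a valuation $\mu$ of $K[x]$, polynomials $\phi_\alpha$ all of the same degree, and values $\gamma_\alpha\in\tilde\Gamma$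 such that, for every $\alpha$, $\phi_\alpha$ is a key polynomial for $\mu$, $\gamma_\alpha>\mu(\phi_\alpha)$ and $\mu_\alpha=[\mu;\phi_\alpha,\gamma_\alpha]$, and such that, for all $\alpha<\beta$, $\phi_\beta$ is a key polynomial for $\mu_\alpha$, $\gamma_\beta>\gamma_\alpha=\mu_\alpha(\phi_\beta)$ and $\mu_\beta=[\mu_\alpha;\phi_\beta,\gamma_\beta]$. Let $\phi$ be a limit key polynomial for $\mathcal C$, i.e. a monic polynomial of minimal degree in $\{f : \mu_\alpha(f)<\mu_\beta(f)\ \text{for all } \alpha<\beta \text{ in } A\}$, and let $\gamma\in\tilde\Gamma$ satisfy $\gamma>\mu_\alpha(\phi)$ for all $\alpha\in A$. Say that $\phi$ $A$-divides $g$ if there is $\alpha\in A$ such that $\phi$ $\mu_\beta$-divides $g$ for all $\beta\ge\alpha$. Then for every $g\in K[x]$ that has degree $<\deg\phi$ or is not $A$-divisible by $\phi$, the supremum $\mu_A(g)=\sup_{\alpha\in A}\mu_\alpha(g)$ exists and $\mu_\alpha(g)=\mu_A(g)$ for all sufficiently large $\alpha$. Let $\mu'$ be the limit augmented valuation $[\mathcal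 C;\mu'(\phi)=\gamma]$, which sends $f=\sum_j g_j\phi^j$ (with $\deg g_j<\deg\phi$) to $\inf_j(\mu_A(g_j)+j\gamma)$. If $$f=f_m\phi^m+\dots+f_1\phi+f_0$$ with polynomials $f_0,\dots,f_m\in K[x]$ (of arbitrary degrees), none of which is $A$-divisible by $\phi$, then $$\mu'(f)=\inf_{0\le j\le m}\bigl(\mu_A(f_j)+j\gamma\bigr).$$ -/

import Mathlib

open Polynomial Filter

noncomputable section

namespace LimitAug

variable {K Γ A : Type*} [Field K] [AddCommGroup Γ] [LinearOrder Γ] [IsOrderedAddMonoid Γ]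

/-- `f` is `μ`-divisible by `φ`: some multiple `h φ` of `φ` is `μ`-equivalent to `f`,
that is `μ (f - h φ) > μ f`. (In particular `0` is not `μ`-divisible by any polynomial.) -/
def MuDvd (μ : AddValuation K[X] (WithTop Γ)) (φ f : K[X]) : Prop :=
  ∃ h : K[X], μ f < μ (f - h * φ)

/-- (MacLane) key polynomial for `μ`: monic, non-constant, `μ`-minimal and `μ`-irreducible. -/
structure IsKeyPolynomial (μ : AddValuation K[X] (WithTop Γ)) (φ : K[X]) : Prop where
  monic : φ.Monic
  natDegree_pos : 0 < φ.natDegree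
  minimal : ∀ f : K[X], MuDvd μ φ f → φ.natDegree ≤ f.natDegree
  irreducible : ∀ f g : K[X], MuDvd μ φ (f * g) → MuDvd μ φ f ∨ MuDvd μ φ g

/-- The coefficient `g_j`, with `deg g_j < deg φ`, in the expansion
`f = g_m φ ^ m + ⋯ + g_1 φ + g_0` of `f` in powers of a monic non-constant `φ`. -/
def digit (φ f : K[X]) (j : ℕ) : K[X] := (f /ₘ φ ^ j) %ₘ φ

/-- `Inf (w (g_j) + j γ)` over the expansion `f = ∑ g_j φ ^ j` with `deg g_j < deg φ`.
For `j > deg f` the coefficient `g_j` vanishes. -/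
def expansionInf (w : K[X] → WithTop Γ) (φ : K[X]) (γ : Γ) (f : K[X]) : WithTop Γ :=
  (Finset.range (f.natDegree + 1)).inf fun j => w (digit φ f j) + ((j • γ : Γ) : WithTop Γ)

/-- `μ' = [μ ; μ' φ = γ]` is the augmented valuation of `μ` associated with the key polynomial
`φ` of `μ` and the value `γ > μ φ`. -/
structure IsAugmentation (μ : AddValuation K[X] (WithTop Γ)) (φ : K[X]) (γ : Γ)
    (μ' : AddValuation K[X] (WithTop Γ)) : Prop where
  key : IsKeyPolynomial μ φ
  lt : μ φ < (γ : WithTop Γ)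
  apply_eq : ∀ f : K[X], μ' f = expansionInf μ φ γ f

/-- A continuous admissible family `(μ_α)` of valuations of `K[X]` extending `ν`, indexed by a
totally ordered set `A`, with base valuation `base`, key polynomials `key α` and values `γ α`.
(`A` is required to be nonempty and without greatest element in the theorem.)
That every `val α` extends `ν` and takes the value `∞` only at `0` follows from the same
properties of `base`. -/
structure ContinuousFamily (ν : AddValuation K (WithTop Γ)) (A : Type*) [LinearOrder A] where
  /-- the given valuation `μ` -/
  base : AddValuation K[X] (WithTop Γ)
  base_extends : ∀ a : K, base (C a) = ν a
  /-- `base` is a valuation, not only a pseudo-valuation -/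
  base_eq_top : ∀ f : K[X], base f = ⊤ → f = 0
  /-- the valuations `μ_α` -/
  val : A → AddValuation K[X] (WithTop Γ)
  /-- the key polynomials `φ_α` -/
  key : A → K[X]
  /-- the values `γ_α` -/
  γ : A → Γ
  natDegree_key : ∀ α β : A, (key α).natDegree = (key β).natDegree
  val_base : ∀ α : A, IsAugmentation base (key α) (γ α) (val α)
  val_step : ∀ α β : A, α < β → IsAugmentation (val α) (key β) (γ β) (val β)
  val_key : ∀ α β : A, α < β → val α (key β) = (γ α : WithTop Γ)
  γ_lt : ∀ α β : A, α < β → γ α < γ β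

namespace ContinuousFamily

variable [LinearOrder A] {ν : AddValuation K (WithTop Γ)} (F : ContinuousFamily ν A)

/-- The polynomials whose values `μ_α f` are strictly increasing in `α`. -/
def increasing : Set K[X] := {f | ∀ α β : A, α < β → F.val α f < F.val β f}

/-- Limit key polynomial: a monic polynomial of minimal degree in `F.increasing`. -/
structure IsLimitKeyPolynomial (φ : K[X]) : Prop where
  monic : φ.Monic
  mem : φ ∈ F.increasing
  minimal : ∀ f ∈ F.increasing, φ.natDegree ≤ f.natDegree

/-- `φ` `A`-divides `f`: it `μ_β`-divides `f` for all sufficiently large `β`. -/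
def ADvd (φ f : K[X]) : Prop := ∃ α : A, ∀ β : A, α ≤ β → MuDvd (F.val β) φ f

open Classical in
/-- The value `μ_A f`, the eventual value of `α ↦ μ_α f`; it is meaningful only where this map
is eventually constant (otherwise the default is `∞`). -/
def limVal (f : K[X]) : WithTop Γ :=
  if h : ∃ v : WithTop Γ, ∀ᶠ α in (atTop : Filter A), F.val α f = v then h.choose else ⊤

/-- The limit augmented valuation `[(μ_α) ; μ' φ = γ]`, as a function on `K[X]`. -/
def limitAugmentation (φ : K[X]) (γ : Γ) : K[X] → WithTop Γ :=
  expansionInf F.limVal φ γ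

end ContinuousFamily

end LimitAug

end

/-!
If `μ_α f = μ_β f` for some `α < β`, then `μ_δ f = μ_α f` for all `δ ≥ α`: for `δ > β`, if `φ_δ`
`μ_α`-divided `f`, then `μ_α f < μ_β f` would follow from `μ_α φ_δ = γ_α < γ_β = μ_β φ_δ`. Hence
`α ↦ μ_α f` is either strictly increasing or eventually constant, and the latter holds when
`deg f < deg φ`.

Division with remainder `f = q φ + r` gives `μ_β f ≤ μ_β r` for large `β`: otherwise `μ_β (q φ)`
would equal the eventually constant `μ_β r`, although `μ_β φ` is strictly increasing. If `φ` does
not `A`-divide `f`, equality holds for large `β`.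

Only finitely many polynomials enter the formula for `μ'`, so `μ_A` may be replaced by a single
`μ_β`. For the infimum `E` over the `φ`-expansion with respect to `μ_β`, Horner's scheme reduces
the formula to `E (f₀ + g φ) = min (μ_β f₀) (E g + γ)`.
-/

namespace LimitAug

section DivByMonic

variable {R : Type*} [CommRing R]

lemma divByMonic_mul_self (p q : R[X]) : p /ₘ q * q = p - p %ₘ q := by
  rw [eq_sub_iff_add_eq', mul_comm, modByMonic_add_div]

lemma add_divByMonic (p₁ p₂ q : R[X]) : (p₁ + p₂) /ₘ q = p₁ /ₘ q + p₂ /ₘ q := by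
  by_cases hq : q.Monic
  · apply hq.isRegular.right
    simp only [add_mul, divByMonic_mul_self, add_modByMonic]
    ring
  · simp only [divByMonic_eq_of_not_monic _ hq, add_zero]

lemma neg_divByMonic (p q : R[X]) : (-p) /ₘ q = -(p /ₘ q) := by
  rw [eq_neg_iff_add_eq_zero, ← add_divByMonic, neg_add_cancel, zero_divByMonic]

lemma divByMonic_mul {p q : R[X]} (hp : p.Monic) (hq : q.Monic) (f : R[X]) :
    f /ₘ (p * q) = f /ₘ p /ₘ q := by
  nontriviality R
  refine (div_modByMonic_unique (f /ₘ p /ₘ q) (f %ₘ p + p * (f /ₘ p %ₘ q)) (hp.mul hq) ⟨?_, ?_⟩).1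
  · linear_combination p * modByMonic_add_div (f /ₘ p) q + modByMonic_add_div f p
  · rw [hq.degree_mul]
    refine (degree_add_le _ _).trans_lt (max_lt ?_ ?_)
    · exact (degree_modByMonic_lt f hp).trans_le
        (le_add_of_nonneg_right (zero_le_degree_iff.2 hq.ne_zero))
    · refine (degree_mul_le _ _).trans_lt (WithBot.add_lt_add_left ?_ (degree_modByMonic_lt _ hq))
      exact degree_ne_bot.2 hp.ne_zero

end DivByMonic

section Digit

variable {K : Type*} [Field K] {φ : K[X]}

lemma digit_zero (φ f : K[X]) : digit φ f 0 = f %ₘ φ := by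
  rw [digit, pow_zero, divByMonic_one]

lemma digit_succ (hφ : φ.Monic) (f : K[X]) (j : ℕ) :
    digit φ f (j + 1) = digit φ (f /ₘ φ) j := by
  rw [digit, pow_succ', divByMonic_mul hφ (hφ.pow j), digit]

lemma digit_add (φ f g : K[X]) (j : ℕ) : digit φ (f + g) j = digit φ f j + digit φ g j := by
  simp only [digit, add_divByMonic, add_modByMonic]

lemma digit_neg (φ f : K[X]) (j : ℕ) : digit φ (-f) j = -digit φ f j := by
  simp only [digit, neg_divByMonic, neg_modByMonic]

lemma digit_eq_zero_of_natDegree_lt (hφ : φ.Monic) (hd : 0 < φ.natDegree) {f : K[X]} {j : ℕ}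
    (hj : f.natDegree < j) : digit φ f j = 0 := by
  have hdeg : f.degree < (φ ^ j).degree := by
    refine degree_lt_degree (hj.trans_le ?_)
    rw [hφ.natDegree_pow]
    exact Nat.le_mul_of_pos_right j hd
  rw [digit, (divByMonic_eq_zero_iff (hφ.pow j)).2 hdeg, zero_modByMonic]

end Digit

section Valuation

variable {R Γ : Type*} [Ring R] [AddCommGroup Γ] [LinearOrder Γ] [IsOrderedAddMonoid Γ]
  {μ μ' : AddValuation R (WithTop Γ)}

lemma map_mul_lt_map_mul (hle : ∀ x, μ x ≤ μ' x) {q x : R} (hq : μ q ≠ ⊤) (hx : μ x < μ' x) :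
    μ (q * x) < μ' (q * x) := by
  rw [μ.map_mul, μ'.map_mul]
  calc μ q + μ x < μ q + μ' x := WithTop.add_lt_add_left hq hx
    _ ≤ μ' q + μ' x := by gcongr; exact hle q

end Valuation

section FinsetInf

lemma inf_range_succ' {α : Type*} [SemilatticeInf α] [OrderTop α] (t : ℕ → α) (n : ℕ) :
    (Finset.range (n + 1)).inf t = t 0 ⊓ (Finset.range n).inf fun j => t (j + 1) := by
  rw [Finset.range_add_one', Finset.inf_insert, Finset.inf_map]
  rfl

lemma finsetInf_add_coe {ι Γ : Type*} [AddCommGroup Γ] [LinearOrder Γ] [IsOrderedAddMonoid Γ]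
    (s : Finset ι) (t : ι → WithTop Γ) (γ : Γ) :
    s.inf t + (γ : WithTop Γ) = s.inf fun i => t i + (γ : WithTop Γ) :=
  Finset.apply_inf_eq_inf_comp (· + (γ : WithTop Γ)) (fun x y => (min_add_add_right x y _).symm)
    (top_add _)

end FinsetInf

section ExpansionInf

variable {K Γ : Type*} [Field K] [AddCommGroup Γ] [LinearOrder Γ] {w : K[X] → WithTop Γ}
  {φ : K[X]} {γ : Γ}

lemma le_expansionInf_iff (hw : w 0 = ⊤) (hφ : φ.Monic) (hd : 0 < φ.natDegree) {f : K[X]}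
    {c : WithTop Γ} :
    c ≤ expansionInf w φ γ f ↔ ∀ j, c ≤ w (digit φ f j) + ((j • γ : Γ) : WithTop Γ) := by
  refine ⟨fun h j => ?_, fun h => Finset.le_inf fun j _ => h j⟩
  rcases lt_or_ge f.natDegree j with hj | hj
  · simp [digit_eq_zero_of_natDegree_lt hφ hd hj, hw]
  · exact h.trans (Finset.inf_le (Finset.mem_range_succ_iff.2 hj))

lemma expansionInf_le (hw : w 0 = ⊤) (hφ : φ.Monic) (hd : 0 < φ.natDegree) (f : K[X]) (j : ℕ) :
    expansionInf w φ γ f ≤ w (digit φ f j) + ((j • γ : Γ) : WithTop Γ) :=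
  (le_expansionInf_iff hw hφ hd).1 le_rfl j

variable [IsOrderedAddMonoid Γ] {μ : AddValuation K[X] (WithTop Γ)}

lemma expansionInf_eq_min (hw : w 0 = ⊤) (hφ : φ.Monic) (hd : 0 < φ.natDegree) (f : K[X]) :
    expansionInf w φ γ f = min (w (f %ₘ φ)) (expansionInf w φ γ (f /ₘ φ) + (γ : WithTop Γ)) := by
  have hterm (j : ℕ) : w (digit φ f (j + 1)) + (((j + 1) • γ : Γ) : WithTop Γ) =
      w (digit φ (f /ₘ φ) j) + ((j • γ : Γ) : WithTop Γ) + (γ : WithTop Γ) := by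
    rw [digit_succ hφ, succ_nsmul, WithTop.coe_add, add_assoc]
  apply le_antisymm
  · refine le_min ?_ ?_
    · simpa [digit_zero] using expansionInf_le (γ := γ) hw hφ hd f 0
    · refine (Finset.le_inf fun j _ => ?_).trans_eq (finsetInf_add_coe _ _ γ).symm
      exact (expansionInf_le hw hφ hd f (j + 1)).trans_eq (hterm j)
  · refine (le_expansionInf_iff hw hφ hd).2 fun j => ?_
    cases j with
    | zero => simp [digit_zero]
    | succ j =>
      rw [hterm]
      refine (min_le_right _ _).trans ?_
      gcongr
      exact expansionInf_le hw hφ hd _ j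

lemma le_expansionInf_of_le_digit (hφ : φ.Monic) (hγ : μ φ ≤ (γ : WithTop Γ)) {f : K[X]}
    (hf : ∀ j ≤ f.natDegree, μ (f /ₘ φ ^ j) ≤ μ (digit φ f j)) :
    μ f ≤ expansionInf μ φ γ f := by
  have hdiv (j : ℕ) (hj : j ≤ f.natDegree + 1) :
      μ f ≤ μ (f /ₘ φ ^ j) + ((j • γ : Γ) : WithTop Γ) := by
    induction j with
    | zero => simp
    | succ j ih =>
      have hquot : μ (f /ₘ φ ^ j) ≤ μ (f /ₘ φ ^ (j + 1)) + (γ : WithTop Γ) :=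
        calc μ (f /ₘ φ ^ j) ≤ μ (f /ₘ φ ^ j - f /ₘ φ ^ j %ₘ φ) :=
              μ.map_le_sub le_rfl (hf j (by omega))
          _ = μ (f /ₘ φ ^ (j + 1)) + μ φ := by
              rw [pow_succ, divByMonic_mul (hφ.pow j) hφ, ← divByMonic_mul_self, μ.map_mul]
          _ ≤ μ (f /ₘ φ ^ (j + 1)) + (γ : WithTop Γ) := by gcongr
      calc μ f ≤ μ (f /ₘ φ ^ j) + ((j • γ : Γ) : WithTop Γ) := ih (by omega)
        _ ≤ μ (f /ₘ φ ^ (j + 1)) + (γ : WithTop Γ) + ((j • γ : Γ) : WithTop Γ) := by gcongr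
        _ = μ (f /ₘ φ ^ (j + 1)) + (((j + 1) • γ : Γ) : WithTop Γ) := by
            rw [succ_nsmul', WithTop.coe_add, add_assoc]
  refine Finset.le_inf fun j hj => ?_
  have hj' : j ≤ f.natDegree := Finset.mem_range_succ_iff.1 hj
  refine (hdiv j (by omega)).trans ?_
  gcongr
  exact hf j hj'

lemma expansionInf_neg (φ : K[X]) (γ : Γ) (f : K[X]) :
    expansionInf μ φ γ (-f) = expansionInf μ φ γ f := by
  simp only [expansionInf, natDegree_neg, digit_neg, μ.map_neg]

lemma min_expansionInf_le_add (hφ : φ.Monic) (hd : 0 < φ.natDegree) (f g : K[X]) :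
    min (expansionInf μ φ γ f) (expansionInf μ φ γ g) ≤ expansionInf μ φ γ (f + g) := by
  refine (le_expansionInf_iff μ.map_zero hφ hd).2 fun j => ?_
  calc min (expansionInf μ φ γ f) (expansionInf μ φ γ g)
      ≤ min (μ (digit φ f j) + ((j • γ : Γ) : WithTop Γ))
          (μ (digit φ g j) + ((j • γ : Γ) : WithTop Γ)) :=
        min_le_min (expansionInf_le μ.map_zero hφ hd f j) (expansionInf_le μ.map_zero hφ hd g j)
    _ = min (μ (digit φ f j)) (μ (digit φ g j)) + ((j • γ : Γ) : WithTop Γ) :=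
        min_add_add_right _ _ _
    _ ≤ μ (digit φ (f + g) j) + ((j • γ : Γ) : WithTop Γ) := by
        rw [digit_add]
        gcongr
        exact μ.map_add _ _

lemma min_expansionInf_add_coe_le (hφ : φ.Monic) (hd : 0 < φ.natDegree) {f : K[X]} {c : WithTop Γ}
    (hf : c ≤ expansionInf μ φ γ f + (γ : WithTop Γ)) (g : K[X]) :
    min c (expansionInf μ φ γ g + (γ : WithTop Γ)) ≤
      expansionInf μ φ γ (f + g) + (γ : WithTop Γ) :=
  calc min c (expansionInf μ φ γ g + (γ : WithTop Γ))
      ≤ min (expansionInf μ φ γ f + (γ : WithTop Γ))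
          (expansionInf μ φ γ g + (γ : WithTop Γ)) := min_le_min_right _ hf
    _ = min (expansionInf μ φ γ f) (expansionInf μ φ γ g) + (γ : WithTop Γ) :=
        min_add_add_right _ _ _
    _ ≤ expansionInf μ φ γ (f + g) + (γ : WithTop Γ) := by
        gcongr
        exact min_expansionInf_le_add hφ hd f g

lemma expansionInf_add_mul (hφ : φ.Monic) (hd : 0 < φ.natDegree) {f : K[X]}
    (hmod : μ (f %ₘ φ) = μ f) (hle : μ f ≤ expansionInf μ φ γ f) (g : K[X]) :
    expansionInf μ φ γ (f + g * φ) =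
      min (μ f) (expansionInf μ φ γ g + (γ : WithTop Γ)) := by
  have hrem : (f + g * φ) %ₘ φ = f %ₘ φ := by
    rw [add_modByMonic, mul_self_modByMonic hφ, add_zero]
  have hquot : (f + g * φ) /ₘ φ = f /ₘ φ + g := by
    rw [add_divByMonic, mul_comm g, mul_divByMonic_cancel_left g hφ]
  have hdiv : μ f ≤ expansionInf μ φ γ (f /ₘ φ) + (γ : WithTop Γ) :=
    hle.trans ((expansionInf_eq_min μ.map_zero hφ hd f).trans_le (min_le_right _ _))
  rw [expansionInf_eq_min μ.map_zero hφ hd, hrem, hmod, hquot]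
  apply le_antisymm <;> refine le_min (min_le_left _ _) ?_
  · rw [← expansionInf_neg] at hdiv
    simpa using min_expansionInf_add_coe_le hφ hd hdiv (f /ₘ φ + g)
  · exact min_expansionInf_add_coe_le hφ hd hdiv g

theorem expansionInf_sum_mul_pow (hφ : φ.Monic) (hd : 0 < φ.natDegree) (n : ℕ) (f : ℕ → K[X])
    (hmod : ∀ j < n, μ (f j %ₘ φ) = μ (f j))
    (hle : ∀ j < n, μ (f j) ≤ expansionInf μ φ γ (f j)) :
    expansionInf μ φ γ (∑ j ∈ Finset.range n, f j * φ ^ j) =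
      (Finset.range n).inf fun j => μ (f j) + ((j • γ : Γ) : WithTop Γ) := by
  induction n generalizing f with
  | zero => simp [expansionInf, digit]
  | succ n ih =>
    have hhorner : ∑ j ∈ Finset.range (n + 1), f j * φ ^ j =
        f 0 + (∑ j ∈ Finset.range n, f (j + 1) * φ ^ j) * φ := by
      rw [Finset.sum_range_succ', Finset.sum_mul, pow_zero, mul_one, add_comm]
      simp only [pow_succ, mul_assoc]
    rw [hhorner, expansionInf_add_mul hφ hd (hmod 0 n.succ_pos) (hle 0 n.succ_pos),
      ih (fun j => f (j + 1)) (fun j hj => hmod _ (by omega)) (fun j hj => hle _ (by omega)),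
      finsetInf_add_coe, inf_range_succ', zero_nsmul, WithTop.coe_zero, add_zero]
    simp only [succ_nsmul, WithTop.coe_add, add_assoc]

end ExpansionInf

section Augmentation

variable {K Γ : Type*} [Field K] [AddCommGroup Γ] [LinearOrder Γ] [IsOrderedAddMonoid Γ]
  {μ μ' : AddValuation K[X] (WithTop Γ)} {φ f : K[X]} {γ : Γ}

lemma muDvd_of_lt_modByMonic (h : μ f < μ (f %ₘ φ)) : MuDvd μ φ f :=
  ⟨f /ₘ φ, by rwa [divByMonic_mul_self, sub_sub_cancel]⟩

lemma MuDvd.lt_of_lt (hf : MuDvd μ φ f) (hle : ∀ g, μ g ≤ μ' g) (hφ : μ φ < μ' φ) :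
    μ f < μ' f := by
  obtain ⟨q, hq⟩ := hf
  have hmul : μ (q * φ) = μ f := by
    rw [← μ.map_sub_eq_of_lt_left hq, sub_sub_cancel]
  have hq_ne_top : μ q ≠ ⊤ := by
    rintro htop
    rw [μ.map_mul, htop, top_add] at hmul
    exact not_top_lt (hmul ▸ hq)
  have hmul_lt : μ f < μ' (q * φ) := hmul ▸ map_mul_lt_map_mul hle hq_ne_top hφ
  simpa using μ'.map_lt_add (hq.trans_le (hle _)) hmul_lt

lemma IsKeyPolynomial.le_modByMonic (hφ : IsKeyPolynomial μ φ) (f : K[X]) :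
    μ f ≤ μ (f %ₘ φ) := by
  by_contra! h
  have hdvd : MuDvd μ φ (f %ₘ φ) :=
    ⟨-(f /ₘ φ), by rwa [neg_mul, divByMonic_mul_self, sub_neg_eq_add, add_sub_cancel]⟩
  have hφ_ne_one : φ ≠ 1 := by
    rintro rfl
    simpa using hφ.natDegree_pos
  exact (hφ.minimal _ hdvd).not_gt (natDegree_modByMonic_lt f hφ.monic hφ_ne_one)

namespace IsAugmentation

lemma le_apply (h : IsAugmentation μ φ γ μ') (f : K[X]) : μ f ≤ μ' f := by
  rw [h.apply_eq]
  exact le_expansionInf_of_le_digit h.key.monic h.lt.le fun j _ => h.key.le_modByMonic _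

lemma apply_eq_of_not_muDvd (h : IsAugmentation μ φ γ μ') (hf : ¬ MuDvd μ φ f) : μ' f = μ f := by
  refine le_antisymm ?_ (h.le_apply f)
  calc μ' f ≤ μ (f %ₘ φ) := by
        simpa [h.apply_eq, digit_zero] using
          expansionInf_le (γ := γ) μ.map_zero h.key.monic h.key.natDegree_pos f 0
    _ ≤ μ f := not_lt.1 (mt muDvd_of_lt_modByMonic hf)

end IsAugmentation

end Augmentation

lemma isLUB_range_of_eventually_eq {ι α : Type*} [Preorder ι] [IsDirectedOrder ι] [Nonempty ι]
    [Preorder α] {u : ι → α} (hu : Monotone u) {a : α} (h : ∀ᶠ i in atTop, u i = a) :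
    IsLUB (Set.range u) a := by
  constructor
  · rintro _ ⟨i, rfl⟩
    obtain ⟨j, rfl, hij⟩ := (h.and (eventually_ge_atTop i)).exists
    exact hu hij
  · intro b hb
    obtain ⟨i, rfl⟩ := h.exists
    exact hb ⟨i, rfl⟩

namespace ContinuousFamily

variable {K Γ A : Type*} [Field K] [AddCommGroup Γ] [LinearOrder Γ] [IsOrderedAddMonoid Γ]
  [LinearOrder A] {ν : AddValuation K (WithTop Γ)} (F : ContinuousFamily ν A) {φ f : K[X]}

lemma monotone_val (f : K[X]) : Monotone fun α => F.val α f :=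
  monotone_iff_forall_lt.2 fun α β h => (F.val_step α β h).le_apply f

lemma val_eq_of_val_eq {α β δ : A} (hαβ : α < β) (h : F.val α f = F.val β f) (hδ : α ≤ δ) :
    F.val δ f = F.val α f := by
  rcases le_or_gt δ β with hδβ | hβδ
  · exact le_antisymm (h ▸ F.monotone_val f hδβ) (F.monotone_val f hδ)
  · have hkey : F.val α (F.key δ) < F.val β (F.key δ) := by
      rw [F.val_key α δ (hαβ.trans hβδ), F.val_key β δ hβδ]
      exact WithTop.coe_lt_coe.2 (F.γ_lt α β hαβ)
    exact (F.val_step α δ (hαβ.trans hβδ)).apply_eq_of_not_muDvd fun hdvd =>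
      (hdvd.lt_of_lt (F.monotone_val · hαβ.le) hkey).ne h

lemma exists_forall_ge_val_eq (hf : f ∉ F.increasing) :
    ∃ v, ∃ α, ∀ β, α ≤ β → F.val β f = v := by
  simp only [increasing, Set.mem_ofPred_eq, not_forall, not_lt] at hf
  obtain ⟨α, β, hαβ, hβα⟩ := hf
  have h : F.val α f = F.val β f := (F.monotone_val f hαβ.le).antisymm hβα
  exact ⟨F.val α f, α, fun δ hδ => F.val_eq_of_val_eq hαβ h hδ⟩

lemma eventually_val_eq_limVal (hf : f ∉ F.increasing) :
    ∀ᶠ α in (atTop : Filter A), F.val α f = F.limVal f := by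
  have hex : ∃ v, ∀ᶠ α in (atTop : Filter A), F.val α f = v := by
    obtain ⟨v, α, hα⟩ := F.exists_forall_ge_val_eq hf
    exact ⟨v, (eventually_ge_atTop α).mono hα⟩
  rw [limVal, dif_pos hex]
  exact hex.choose_spec

lemma isLUB_limVal [Nonempty A] (hf : f ∉ F.increasing) :
    IsLUB (Set.range fun α : A => F.val α f) (F.limVal f) :=
  isLUB_range_of_eventually_eq (F.monotone_val f) (F.eventually_val_eq_limVal hf)

lemma frequently_modByMonic_le_of_not_aDvd [Nonempty A] (hf : ¬ F.ADvd φ f) :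
    ∃ᶠ α in (atTop : Filter A), F.val α (f %ₘ φ) ≤ F.val α f := by
  simp only [Filter.Frequently, not_le]
  exact fun h => hf (eventually_atTop.1 (h.mono fun α => muDvd_of_lt_modByMonic))

namespace IsLimitKeyPolynomial

variable {F} [Nonempty A] [NoMaxOrder A]

lemma natDegree_pos (hφ : F.IsLimitKeyPolynomial φ) : 0 < φ.natDegree := by
  refine Nat.pos_of_ne_zero fun h => ?_
  obtain rfl := hφ.monic.natDegree_eq_zero.1 h
  obtain ⟨α⟩ := ‹Nonempty A›
  obtain ⟨β, hαβ⟩ := exists_gt α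
  simpa using hφ.mem α β hαβ

lemma notMem_increasing_of_degree_lt (hφ : F.IsLimitKeyPolynomial φ) (hf : f.degree < φ.degree) :
    f ∉ F.increasing := by
  intro hmem
  have hlt : f.natDegree < φ.natDegree := by
    rcases eq_or_ne f 0 with rfl | hf0
    · simpa using hφ.natDegree_pos
    · exact natDegree_lt_natDegree hf0 hf
  exact (hφ.minimal f hmem).not_gt hlt

lemma eventually_modByMonic_eq_limVal (hφ : F.IsLimitKeyPolynomial φ) (f : K[X]) :
    ∀ᶠ α in (atTop : Filter A), F.val α (f %ₘ φ) = F.limVal (f %ₘ φ) :=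
  F.eventually_val_eq_limVal
    (hφ.notMem_increasing_of_degree_lt (degree_modByMonic_lt f hφ.monic))

lemma eventually_le_modByMonic (hφ : F.IsLimitKeyPolynomial φ) (f : K[X]) :
    ∀ᶠ α in (atTop : Filter A), F.val α f ≤ F.val α (f %ₘ φ) := by
  obtain ⟨α₀, hconst⟩ := eventually_atTop.1 (hφ.eventually_modByMonic_eq_limVal f)
  filter_upwards [eventually_ge_atTop α₀] with α hα
  by_contra! hlt
  have hmul (β : A) (hβ : α ≤ β) : F.val β (f /ₘ φ * φ) = F.limVal (f %ₘ φ) := by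
    rw [← hconst β (hα.trans hβ), divByMonic_mul_self]
    refine (F.val β).map_sub_eq_of_lt_right ?_
    rw [hconst β (hα.trans hβ), ← hconst α hα]
    exact hlt.trans_le (F.monotone_val f hβ)
  have hquot : F.val α (f /ₘ φ) ≠ ⊤ := by
    intro htop
    have hmul_top := hmul α le_rfl
    rw [(F.val α).map_mul, htop, top_add, ← hconst α hα] at hmul_top
    exact hlt.ne_top hmul_top.symm
  obtain ⟨β, hαβ⟩ := exists_gt α
  have hstrict := map_mul_lt_map_mul (F.monotone_val · hαβ.le) hquot (hφ.mem α β hαβ)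
  exact hstrict.ne ((hmul α le_rfl).trans (hmul β hαβ.le).symm)

lemma aDvd_of_mem_increasing (hφ : F.IsLimitKeyPolynomial φ) (hf : f ∈ F.increasing) :
    F.ADvd φ f := by
  by_contra hndvd
  obtain ⟨α₀, h⟩ := eventually_atTop.1
    ((hφ.eventually_le_modByMonic f).and (hφ.eventually_modByMonic_eq_limVal f))
  obtain ⟨α, hle, hα⟩ := ((F.frequently_modByMonic_le_of_not_aDvd hndvd).and_eventually
    (eventually_ge_atTop α₀)).exists
  obtain ⟨β, hαβ⟩ := exists_gt α
  have hβ := h β (hα.trans hαβ.le)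
  refine (hf α β hαβ).not_ge ?_
  calc F.val β f ≤ F.val β (f %ₘ φ) := hβ.1
    _ = F.val α (f %ₘ φ) := hβ.2.trans (h α hα).2.symm
    _ ≤ F.val α f := hle

lemma notMem_increasing_of_not_aDvd (hφ : F.IsLimitKeyPolynomial φ) (hf : ¬ F.ADvd φ f) :
    f ∉ F.increasing :=
  mt hφ.aDvd_of_mem_increasing hf

lemma eventually_modByMonic_eq (hφ : F.IsLimitKeyPolynomial φ) (hf : ¬ F.ADvd φ f) :
    ∀ᶠ α in (atTop : Filter A), F.val α (f %ₘ φ) = F.val α f := by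
  have hmod := hφ.eventually_modByMonic_eq_limVal f
  have hlim := F.eventually_val_eq_limVal (hφ.notMem_increasing_of_not_aDvd hf)
  have hle : F.limVal (f %ₘ φ) ≤ F.limVal f := by
    obtain ⟨α, hα, hαmod, hαlim⟩ := ((F.frequently_modByMonic_le_of_not_aDvd hf).and_eventually
      (hmod.and hlim)).exists
    rwa [hαmod, hαlim] at hα
  filter_upwards [hmod, hlim, hφ.eventually_le_modByMonic f] with α hαmod hαlim hα
  exact le_antisymm (by rwa [hαmod, hαlim]) hα

variable {γ : Γ}

lemma eventually_le_expansionInf (hφ : F.IsLimitKeyPolynomial φ)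
    (hγ : ∀ α : A, F.val α φ ≤ (γ : WithTop Γ)) (f : K[X]) :
    ∀ᶠ α in (atTop : Filter A), F.val α f ≤ expansionInf (F.val α) φ γ f := by
  have hdigits : ∀ᶠ α in (atTop : Filter A), ∀ j ∈ Set.Iic f.natDegree,
      F.val α (f /ₘ φ ^ j) ≤ F.val α (digit φ f j) :=
    (eventually_all_finite (Set.finite_Iic _)).2 fun j _ => hφ.eventually_le_modByMonic _
  filter_upwards [hdigits] with α hα
  exact le_expansionInf_of_le_digit hφ.monic (hγ α) hα

lemma eventually_expansionInf_eq_limitAugmentation (hφ : F.IsLimitKeyPolynomial φ) (γ : Γ)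
    (f : K[X]) :
    ∀ᶠ α in (atTop : Filter A), expansionInf (F.val α) φ γ f = F.limitAugmentation φ γ f := by
  have hdigits : ∀ᶠ α in (atTop : Filter A), ∀ j ∈ Finset.range (f.natDegree + 1),
      F.val α (digit φ f j) = F.limVal (digit φ f j) :=
    (eventually_all_finset _).2 fun j _ => hφ.eventually_modByMonic_eq_limVal _
  filter_upwards [hdigits] with α hα
  exact Finset.inf_congr rfl fun j hj => by rw [hα j hj]

theorem limitAugmentation_sum_mul_pow (hφ : F.IsLimitKeyPolynomial φ)
    (hγ : ∀ α : A, F.val α φ ≤ (γ : WithTop Γ)) (n : ℕ) (f : ℕ → K[X])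
    (hf : ∀ j < n, ¬ F.ADvd φ (f j)) :
    F.limitAugmentation φ γ (∑ j ∈ Finset.range n, f j * φ ^ j) =
      (Finset.range n).inf fun j => F.limVal (f j) + ((j • γ : Γ) : WithTop Γ) := by
  have hcoeff : ∀ᶠ α in (atTop : Filter A), ∀ j ∈ Set.Iio n,
      F.val α (f j %ₘ φ) = F.val α (f j) ∧ F.val α (f j) = F.limVal (f j) ∧
        F.val α (f j) ≤ expansionInf (F.val α) φ γ (f j) :=
    (eventually_all_finite (Set.finite_Iio n)).2 fun j hj =>
      (hφ.eventually_modByMonic_eq (hf j hj)).and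
        ((F.eventually_val_eq_limVal (hφ.notMem_increasing_of_not_aDvd (hf j hj))).and
          (hφ.eventually_le_expansionInf hγ (f j)))
  obtain ⟨α, hα, haug⟩ := (hcoeff.and
    (hφ.eventually_expansionInf_eq_limitAugmentation γ (∑ j ∈ Finset.range n, f j * φ ^ j))).exists
  rw [← haug, expansionInf_sum_mul_pow hφ.monic hφ.natDegree_pos n f
    (fun j hj => (hα j hj).1) (fun j hj => (hα j hj).2.2)]
  exact Finset.inf_congr rfl fun j hj => by rw [(hα j (Finset.mem_range.1 hj)).2.1]

end IsLimitKeyPolynomial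

end ContinuousFamily

end LimitAug

theorem mainTheorem2 {K Γ A : Type*} [Field K]
    [AddCommGroup Γ] [LinearOrder Γ] [IsOrderedAddMonoid Γ]
    [LinearOrder A] [Nonempty A] [NoMaxOrder A]
    (ν : AddValuation K (WithTop Γ)) (F : LimitAug.ContinuousFamily ν A)
    (φ : K[X]) (hφ : F.IsLimitKeyPolynomial φ)
    (γ : Γ) (hγ : ∀ α : A, F.val α φ < (γ : WithTop Γ)) :
    -- `μ_A` is well defined on all polynomials to which it is applied
    (∀ g : K[X], (g.degree < φ.degree ∨ ¬ F.ADvd φ g) →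
      IsLUB (Set.range fun α : A => F.val α g) (F.limVal g) ∧
        ∀ᶠ α in (atTop : Filter A), F.val α g = F.limVal g) ∧
    -- the formula for the limit augmented valuation
    ∀ (m : ℕ) (f : ℕ → K[X]), (∀ j ≤ m, ¬ F.ADvd φ (f j)) →
      F.limitAugmentation φ γ (∑ j ∈ Finset.range (m + 1), f j * φ ^ j) =
        (Finset.range (m + 1)).inf fun j =>
          F.limVal (f j) + ((j • γ : Γ) : WithTop Γ) := by
  refine ⟨fun g hg => ?_, fun m f hf => hφ.limitAugmentation_sum_mul_pow (fun α => (hγ α).le)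
    (m + 1) f fun j hj => hf j (Nat.lt_succ_iff.1 hj)⟩
  have hg_notMem : g ∉ F.increasing :=
    hg.elim hφ.notMem_increasing_of_degree_lt hφ.notMem_increasing_of_not_aDvd
  exact ⟨F.isLUB_limVal hg_notMem, F.eventually_val_eq_limVal hg_notMem⟩
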